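/- Setting. Let $k\ge 3$ and $w$ be integers, and let $p_1,\dots,p_k$ be pairwise coprime positive integers with $w/2\le p_i\le w$ for all $i$. Put $f=4k$ and $J=f\,p_1\cdots p_k$. Let $\mathcal C$ be the $k\times J$ cylindrical grid: its vertices are the pairs $(i,j)$ with row $i\in[k]$ and column $j\in[J]$; $(i,j)$ is adjacent to $(i,j')$ if $|j-j'|=1$, and to $(i',j)$ if $i,i'$ are cyclically consecutive modulo $k$. The left end (right end) consists of the first (last) $f$ columns. Row indices are read modulo $k$. For $t\in[k-1]$ put $P_i=f\,p_i p_{i+1}\cdots p_{i+t}$, and let $\equiv^t$ be the equivalence relation in which every vertex of the two ends is equivalent only to itself, and two vertices $(i,j),(i',j')$ outside the ends are equivalent if and only if $i=i'$ and $P_i\mid j-j'$. A set of $\equiv^t$-classes is also regarded as the set of all vertices in its classes. Semi-separators. A set $S$ of vertices is a vertical separator if no vertex of the left end is connected to a vertex of the right end in $\mathcal C-S$. A $t$-semi-separator for a vertex set $W$ is a vertical separator $S$ such that, for every row $i$, (1) the number of vertices of $S$ in row $i$ is at most the number of $\equiv^t$-classes of which $W$ contains vertices in row $i$, and (2) if $W$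 contains vertices of exactly one class $c$ in row $i$, then all vertices of $S$ in row $i$ belong to $c$. It is minimal if it is inclusion-wise minimal among the $t$-semi-separators for $W$. Critical sets. A path $(u_1,\dots,u_n)$ in $\mathcal C$ is $\ell$-periodic if $u_1$ is in the left end, $u_n$ is in the right end, and for all $i<n$ and all vertices $v$ in the row of $u_i$ whose distance to $u_i$ is divisible by $\ell$, where neither $u_i$ nor $v$ is on an end, there is $j<n$ with $u_j=v$ such that $u_{i+1}$ and $u_{j+1}$ are in the same row at a distance divisible by $\ell$. It induces the twisting $T=\{(u_i,u_{i-1}),(u_i,u_{i+1}) : 1<i<n\}$, and $T$ avoids a vertex set $X$ if it contains no pair $(u,v)$ with $u\in X$. For $R\subseteq[k]$ let $q=\gcd\{P_i : i\in R\}$. A vertex set $W$ is $(R,t)$-separating if there is no $q$-periodic path that uses only vertices of rows in $R$ and whose induced twisting avoids $\{(i,j) : (i,j')\in W \text{ for some } j' \text{ with } q\mid j'-j\}$. The set $W$ is $t$-critical if there is a $t$-semi-separator for $W$ and $W$ is $(R,t)$-separating for all $R\subseteq[k]$ with $|R|\le t+1$. Statement. Let $t\in[k-1]$, and let $W_1,\dots,W_m$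 be $t$-critical sets of at most $k+t$ many $\equiv^t$-classes such that $|W_a\cup W_{a+1}|\le k+t$ for all $a<m$. Let $I\subseteq[k]$ be a set of rows such that, for every row $r\in I$, each $W_a$ contains exactly one class of row $r$, and this class is the same for all $a\in[m]$. Then all minimal $t$-semi-separators for all of the sets $W_a$ coincide on the rows in $I$: if $S$ is a minimal $t$-semi-separator for $W_a$ and $S'$ is one for $W_b$, then $S$ and $S'$ contain the same vertices in every row $r\in I$. If $I$ is nonempty, then there is a $j$ such that all minimal $t$-semi-separators for all of the sets $W_a$ are contained within the columns $j,\dots,j+2(k+t)-1$. -/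

import Mathlib

namespace CylGrid

/-- The width `f(k) = 4k` of each of the two ends of the grid. -/
def endWidth (k : ℕ) : ℕ := 4 * k

/-- The number of columns `J = f(k) * p_1 * ... * p_k`. -/
def numCols {k : ℕ} (p : Fin k → ℕ) : ℕ := endWidth k * ∏ i, p i

/-- Vertices are pairs (row, column). Rows and columns are counted from `0`. -/
abbrev Vertex {k : ℕ} (p : Fin k → ℕ) : Type := Fin k × Fin (numCols p)

/-- The `k × J` cylindrical grid: the rows are arranged in a cycle, the columns in a path. -/
def grid {k : ℕ} (p : Fin k → ℕ) : SimpleGraph (Vertex p) :=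
  (SimpleGraph.cycleGraph k).boxProd (SimpleGraph.pathGraph (numCols p))

/-- The first `f(k)` columns. -/
def leftEnd {k : ℕ} (p : Fin k → ℕ) : Set (Vertex p) :=
  {v | (v.2 : ℕ) < endWidth k}

/-- The last `f(k)` columns. -/
def rightEnd {k : ℕ} (p : Fin k → ℕ) : Set (Vertex p) :=
  {v | numCols p ≤ (v.2 : ℕ) + endWidth k}

/-- The vertices that lie on neither of the two ends. -/
def middle {k : ℕ} (p : Fin k → ℕ) : Set (Vertex p) :=
  {v | v ∉ leftEnd p ∧ v ∉ rightEnd p}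

/-- The period `f(k) * p_i * ... * p_{i+t}` of row `i`, with row indices read cyclically. -/
def period {k : ℕ} (p : Fin k → ℕ) (t : ℕ) (i : Fin k) : ℕ :=
  endWidth k * ∏ s ∈ Finset.range (t + 1), p ⟨((i : ℕ) + s) % k, Nat.mod_lt _ i.pos⟩

/-- `ColCong ℓ u v`: the column indices of `u` and `v` differ by a multiple of `ℓ`. -/
def ColCong {k : ℕ} {p : Fin k → ℕ} (l : ℕ) (u v : Vertex p) : Prop :=
  (l : ℤ) ∣ ((u.2 : ℕ) : ℤ) - ((v.2 : ℕ) : ℤ)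

/-- The compression `≡^t`: it identifies two vertices of the same row outside the ends whose
column indices differ by a multiple of the period of the row. Vertices on the ends are equivalent
only to themselves. -/
def compression {k : ℕ} (p : Fin k → ℕ) (t : ℕ) : Setoid (Vertex p) where
  r u v := u = v ∨
    (u.1 = v.1 ∧ u ∈ middle p ∧ v ∈ middle p ∧ ColCong (period p t u.1) u v)
  iseqv :=
    { refl := fun _ => Or.inl rfl
      symm := by
        rintro u v (h | ⟨h, hu, hv, hd⟩)
        · exact Or.inl h.symm
        · refine Or.inr ⟨h.symm, hv, hu, ?_⟩
          rw [← h]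
          exact (dvd_sub_comm).mp hd
      trans := by
        rintro u v x (rfl | ⟨h, hu, hv, hd⟩) (rfl | ⟨h', hv', hx, hd'⟩)
        · exact Or.inl rfl
        · exact Or.inr ⟨h', hv', hx, hd'⟩
        · exact Or.inr ⟨h, hu, hv, hd⟩
        · refine Or.inr ⟨h.trans h', hu, hx, ?_⟩
          rw [← h] at hd'
          have := dvd_add hd hd'
          rwa [sub_add_sub_cancel] at this }

/-- The type of `≡^t`-classes. -/
abbrev EqClass {k : ℕ} (p : Fin k → ℕ) (t : ℕ) : Type := Quotient (compression p t)

/-- The `≡^t`-class of a vertex. -/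
def toClass {k : ℕ} (p : Fin k → ℕ) (t : ℕ) (v : Vertex p) : EqClass p t :=
  Quotient.mk (compression p t) v

/-- The union of the classes in `W`, a set of vertices. -/
def support {k : ℕ} {p : Fin k → ℕ} {t : ℕ} (W : Set (EqClass p t)) : Set (Vertex p) :=
  {v | toClass p t v ∈ W}

/-- The part of a vertex set that lies in row `i`. -/
def rowPart {k : ℕ} {p : Fin k → ℕ} (X : Set (Vertex p)) (i : Fin k) : Set (Vertex p) :=
  {v | v ∈ X ∧ v.1 = i}

/-- The `≡^t`-classes of which the vertex set `X` contains vertices in row `i`. -/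
def classesInRow {k : ℕ} {p : Fin k → ℕ} (t : ℕ) (X : Set (Vertex p)) (i : Fin k) :
    Set (EqClass p t) :=
  toClass p t '' rowPart X i

/-- A path `u_1, ..., u_m` (here `u_i` is `π.getVert (i - 1)` and `m = π.length + 1`) is
`ℓ`-periodic if it starts in the left end, stops in the right end and, outside the ends, its steps
are repeated at all column shifts by multiples of `ℓ`. -/
def IsPeriodicPath {k : ℕ} {p : Fin k → ℕ} (l : ℕ) {a b : Vertex p}
    (π : (grid p).Walk a b) : Prop :=
  π.IsPath ∧ a ∈ leftEnd p ∧ b ∈ rightEnd p ∧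
    ∀ i < π.length, ∀ v : Vertex p,
      v.1 = (π.getVert i).1 → ColCong l v (π.getVert i) →
      π.getVert i ∈ middle p → v ∈ middle p →
      ∃ j < π.length, π.getVert j = v ∧
        (π.getVert (i + 1)).1 = (π.getVert (j + 1)).1 ∧
        ColCong l (π.getVert (i + 1)) (π.getVert (j + 1))

/-- The twisting `{(u_i, u_{i-1}), (u_i, u_{i+1}) | 1 < i < m}` induced by a path
`u_1, ..., u_m`. -/
def inducedTwisting {k : ℕ} {p : Fin k → ℕ} {a b : Vertex p}
    (π : (grid p).Walk a b) : Set (Vertex p × Vertex p) :=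
  {e | ∃ i, 0 < i ∧ i < π.length ∧
    (e = (π.getVert i, π.getVert (i - 1)) ∨ e = (π.getVert i, π.getVert (i + 1)))}

/-- The twisting `T` avoids the vertex set `X` if it fixes every vertex `u` of `X`, that is,
contains no pair of the form `(u, v)`. -/
def Avoids {k : ℕ} {p : Fin k → ℕ} (T : Set (Vertex p × Vertex p)) (X : Set (Vertex p)) : Prop :=
  ∀ u ∈ X, ∀ v, (u, v) ∉ T

/-- The greatest common divisor of the periods of the rows in `I`. -/
def gcdPeriod {k : ℕ} (p : Fin k → ℕ) (t : ℕ) (I : Finset (Fin k)) : ℕ :=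
  I.gcd (period p t)

/-- `(I, t)`-separating sets of vertices. -/
def IsSeparating {k : ℕ} {p : Fin k → ℕ} (t : ℕ) (I : Finset (Fin k))
    (X : Set (Vertex p)) : Prop :=
  ¬ ∃ (a b : Vertex p) (π : (grid p).Walk a b),
    IsPeriodicPath (gcdPeriod p t I) π ∧ (∀ v ∈ π.support, v.1 ∈ I) ∧
    Avoids (inducedTwisting π)
      {v | ∃ x ∈ X, x.1 = v.1 ∧ ColCong (gcdPeriod p t I) x v}

/-- A vertical separator: after its removal, no vertex of the left end is connected to a vertex of
the right end. -/
def IsVerticalSeparator {k : ℕ} {p : Fin k → ℕ} (S : Set (Vertex p)) : Prop :=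
  ∀ a b : (Sᶜ : Set (Vertex p)), (a : Vertex p) ∈ leftEnd p → (b : Vertex p) ∈ rightEnd p →
    ¬ ((grid p).induce Sᶜ).Reachable a b

/-- `S` is a `t`-semi-separator for the vertex set `X`. -/
def IsSemiSeparator {k : ℕ} {p : Fin k → ℕ} (t : ℕ) (X S : Set (Vertex p)) : Prop :=
  IsVerticalSeparator S ∧
  (∀ i : Fin k, (rowPart S i).ncard ≤ (classesInRow t X i).ncard) ∧
  (∀ (i : Fin k) (c : EqClass p t), classesInRow t X i = {c} →
    ∀ v ∈ rowPart S i, toClass p t v = c)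

/-- `S` is an inclusion-wise minimal `t`-semi-separator for `X`. -/
def IsMinimalSemiSeparator {k : ℕ} {p : Fin k → ℕ} (t : ℕ) (X S : Set (Vertex p)) : Prop :=
  Minimal (IsSemiSeparator t X) S

/-- The vertex set `X` is `t`-critical. -/
def IsCritical {k : ℕ} {p : Fin k → ℕ} (t : ℕ) (X : Set (Vertex p)) : Prop :=
  (∃ S, IsSemiSeparator t X S) ∧
  ∀ I : Finset (Fin k), I.card ≤ t + 1 → IsSeparating t I X

end CylGrid

/-!
Let `S` be an inclusion-minimal vertical separator. If `S` misses a column, then the part of `S` on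
one side of this column is already a separator: the column is connected outside `S`, so it is
either completely reachable from the left end, or not reachable at all
(`IsVerticalSeparator.left_or_right`). Hence the columns that `S` meets form an interval, and two
vertices of `S` are less than `|S|` columns apart (`col_le_of_minimal`). A semi-separator for a set
of at most `k + t` classes has at most `k + t` vertices, so any two of them are at most `k + t - 1`
columns apart.

Now let `S` and `S'` be minimal semi-separators for `W` and `W'`, where `W ∪ W'` has at most `k + t`
classes. Every row contains a vertex of `S`, hence a class of `W`, so all but at most `t` rows contain
exactly one class of `W ∪ W'`. In such a row `i` the separators have one vertex each, and
these are equivalent, so their column indices differ by a multiple `D i` of the period of the row.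
Since `|D i - D i'| ≤ 2 (k + t - 1) < 4 k` and `4 k ∣ D i - D i'`, all the `D i` are the same
number `D`. Each `p j` is a factor of the periods of the `t + 1` rows `j - t, ..., j`, one of which
contains exactly one class, so `4 k * p j ∣ D` for all `j`. As the `p j` are coprime, the number of
columns divides `D`, and `D = 0` (`rowPart_eq_of_union`). The result follows by going through the
sequence of sets one step at a time; criticality is needed for the existence of semi-separators for
the intermediate sets.
-/

namespace CylGrid

variable {k : ℕ} {p : Fin k → ℕ} {t : ℕ}

/-! ### Vertical separators -/

/-- A separator `S` is witnessed by a set of vertices that, outside `S`, contains the left end, is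
closed under adjacency and misses the right end. -/
lemma isVerticalSeparator_iff (S : Set (Vertex p)) :
    IsVerticalSeparator S ↔ ∃ K : Set (Vertex p),
      (∀ v ∈ leftEnd p, v ∉ S → v ∈ K) ∧
      (∀ v ∈ K, v ∉ S → ∀ w, w ∉ S → (grid p).Adj v w → w ∈ K) ∧
      (∀ v ∈ K, v ∉ S → v ∉ rightEnd p) := by
  constructor
  · intro h
    refine ⟨{v | ∃ (hv : v ∉ S) (a : (Sᶜ : Set (Vertex p))), (a : Vertex p) ∈ leftEnd p ∧
      ((grid p).induce Sᶜ).Reachable a ⟨v, hv⟩}, ?_, ?_, ?_⟩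
    · exact fun v hv hvS => ⟨hvS, ⟨v, hvS⟩, hv, SimpleGraph.Reachable.refl _⟩
    · rintro v ⟨hvS, a, ha, hr⟩ - w hwS hadj
      refine ⟨hwS, a, ha, hr.trans (SimpleGraph.Adj.reachable ?_)⟩
      simpa using hadj
    · rintro v ⟨hvS, a, ha, hr⟩ - hvR
      exact h a ⟨v, hvS⟩ ha hvR hr
  · rintro ⟨K, hL, hK, hR⟩ a b ha hb hr
    have key : ∀ c : (Sᶜ : Set (Vertex p)),
        ((grid p).induce Sᶜ).Reachable a c → (c : Vertex p) ∈ K := by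
      intro c hc
      rw [SimpleGraph.reachable_iff_reflTransGen] at hc
      induction hc with
      | refl => exact hL _ ha a.2
      | @tail x y _ hadj ih => exact hK _ ih x.2 _ y.2 (by simpa using hadj)
    exact hR _ (key b hr) b.2 hb

lemma grid_adj_row {i : Fin k} {a b : Fin (numCols p)} (h : (a : ℕ) + 1 = b) :
    (grid p).Adj (i, a) (i, b) := by
  simp [grid, SimpleGraph.boxProd_adj, SimpleGraph.pathGraph_adj, h]

lemma grid_adj_col {i i' : Fin k} {a : Fin (numCols p)} (h : (SimpleGraph.cycleGraph k).Adj i i') :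
    (grid p).Adj (i, a) (i', a) := by
  simp [grid, SimpleGraph.boxProd_adj, h]

lemma col_le_of_adj {v w : Vertex p} (h : (grid p).Adj v w) :
    (w.2 : ℕ) ≤ v.2 + 1 ∧ (v.2 : ℕ) ≤ w.2 + 1 := by
  rw [grid, SimpleGraph.boxProd_adj, SimpleGraph.pathGraph_adj] at h
  rcases h with ⟨-, h⟩ | ⟨h, -⟩
  · rw [h]; omega
  · omega

/-- A separator meets every row, since a row is a path between the two ends. -/
lemma IsVerticalSeparator.rowPart_nonempty {S : Set (Vertex p)} (h : IsVerticalSeparator S)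
    (hJ : 0 < numCols p) (i : Fin k) : (rowPart S i).Nonempty := by
  obtain ⟨K, hL, hK, hR⟩ := (isVerticalSeparator_iff S).1 h
  by_contra hne
  have hS : ∀ a, ((i, a) : Vertex p) ∉ S := fun a ha => hne ⟨(i, a), ha, rfl⟩
  have hk : 0 < endWidth k := by have := i.pos; unfold endWidth; omega
  have key : ∀ n (hn : n < numCols p), ((i, ⟨n, hn⟩) : Vertex p) ∈ K := by
    intro n
    induction n with
    | zero => exact fun hn => hL _ (by simpa [leftEnd] using hk) (hS _)
    | succ n ih =>
      exact fun hn => hK _ (ih (by omega)) (hS _) _ (hS _) (grid_adj_row rfl)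
  refine hR _ (key (numCols p - 1) (by omega)) (hS _) ?_
  simp only [rightEnd, Set.mem_ofPred_eq]
  omega

/-- If a separator misses a column, then its part on one side of this column is a separator. -/
lemma IsVerticalSeparator.left_or_right {S : Set (Vertex p)} (h : IsVerticalSeparator S)
    (c : Fin (numCols p)) (hc : ∀ i, ((i, c) : Vertex p) ∉ S) :
    IsVerticalSeparator {v | v ∈ S ∧ v.2 < c} ∨ IsVerticalSeparator {v | v ∈ S ∧ c < v.2} := by
  obtain ⟨K, hL, hK, hR⟩ := (isVerticalSeparator_iff S).1 h
  have hcS : ∀ v : Vertex p, v.2 = c → v ∉ S := by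
    rintro ⟨i, b⟩ rfl; exact hc i
  by_cases hcol : ∃ i, ((i, c) : Vertex p) ∈ K
  · right
    have hall : ∀ v : Vertex p, v.2 = c → v ∈ K := by
      obtain ⟨i, hi⟩ := hcol
      rintro ⟨j, b⟩ hb
      obtain rfl : b = c := hb
      have hr := SimpleGraph.cycleGraph_preconnected i j
      rw [SimpleGraph.reachable_iff_reflTransGen] at hr
      clear hcS
      induction hr with
      | refl => exact hi
      | tail _ hadj ih => exact hK _ ih (hc _) _ (hc _) (grid_adj_col hadj)
    rw [isVerticalSeparator_iff]
    refine ⟨{v | (v ∈ K ∧ v ∉ S) ∨ v.2 ≤ c}, ?_, ?_, ?_⟩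
    · intro v hv hvB
      by_cases hvc : v.2 ≤ c
      · exact Or.inr hvc
      · have hvS : v ∉ S := fun hs => hvB ⟨hs, not_le.1 hvc⟩
        exact Or.inl ⟨hL v hv hvS, hvS⟩
    · intro v hv _ w hw hadj
      by_cases hwc : w.2 ≤ c
      · exact Or.inr hwc
      have hwS : w ∉ S := fun hs => hw ⟨hs, not_le.1 hwc⟩
      refine Or.inl ⟨?_, hwS⟩
      rcases hv with ⟨hvK, hvS⟩ | hvc
      · exact hK v hvK hvS w hwS hadj
      · have h1 := (col_le_of_adj hadj).1
        have hvc' : v.2 = c := by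
          apply Fin.ext
          rw [Fin.le_def] at hvc hwc
          omega
        exact hK v (hall v hvc') (hcS v hvc') w hwS hadj
    · rintro v (⟨hvK, hvS⟩ | hvc) - hvR
      · exact hR v hvK hvS hvR
      · refine hR (v.1, c) (hall _ rfl) (hc _) ?_
        simp only [rightEnd, Set.mem_ofPred_eq] at hvR ⊢
        rw [Fin.le_def] at hvc
        omega
  · left
    push Not at hcol
    have hcK : ∀ v : Vertex p, v.2 = c → v ∉ K := by
      rintro ⟨i, b⟩ rfl; exact hcol i
    rw [isVerticalSeparator_iff]
    refine ⟨{v | v ∈ K ∧ v.2 < c ∧ v ∉ S}, ?_, ?_, ?_⟩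
    · intro v hv hvA
      have hvc : v.2 < c := by
        -- otherwise the whole column `c` belongs to the left end
        by_contra hvc
        refine hcol v.1 (hL _ ?_ (hc _))
        simp only [leftEnd, Set.mem_ofPred_eq] at hv ⊢
        rw [Fin.lt_def] at hvc
        omega
      have hvS : v ∉ S := fun hs => hvA ⟨hs, hvc⟩
      exact ⟨hL v hv hvS, hvc, hvS⟩
    · rintro v ⟨hvK, hvc, hvS⟩ - w hw hadj
      have h1 := (col_le_of_adj hadj).1
      have hwne : w.2 ≠ c := fun hwc =>
        hcK w hwc (hK v hvK hvS w (hcS w hwc) hadj)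
      have hwc : w.2 < c := by
        rw [Fin.lt_def] at hvc ⊢
        have : (w.2 : ℕ) ≠ c := fun hh => hwne (Fin.ext hh)
        omega
      have hwS : w ∉ S := fun hs => hw ⟨hs, hwc⟩
      exact ⟨hK v hvK hvS w hwS hadj, hwc, hwS⟩
    · rintro v ⟨hvK, -, hvS⟩ -
      exact hR v hvK hvS

/-- The columns that a minimal separator meets form an interval, so its width is at most its
size. -/
lemma col_le_of_minimal {S : Set (Vertex p)} (hS : Minimal IsVerticalSeparator S)
    {u v : Vertex p} (hu : u ∈ S) (hv : v ∈ S) : (v.2 : ℕ) + 1 ≤ u.2 + S.ncard := by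
  have hcols : ∀ n ∈ Finset.Icc (u.2 : ℕ) v.2, ∃ x ∈ S, (x.2 : ℕ) = n := by
    intro n hn
    rw [Finset.mem_Icc] at hn
    by_contra! hne
    rcases hS.1.left_or_right ⟨n, by omega⟩ (fun i hi => hne _ hi rfl) with h | h
    · have := (hS.2 h (fun x hx => hx.1) hv).2
      rw [Fin.lt_def] at this
      simp only at this
      omega
    · have := (hS.2 h (fun x hx => hx.1) hu).2
      rw [Fin.lt_def] at this
      simp only at this
      omega
  have hsub : (Finset.Icc (u.2 : ℕ) v.2 : Set ℕ) ⊆ (fun x : Vertex p => (x.2 : ℕ)) '' S := by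
    intro n hn
    obtain ⟨x, hx, hxn⟩ := hcols n hn
    exact ⟨x, hx, hxn⟩
  have h1 := Set.ncard_le_ncard hsub (Set.toFinite _)
  rw [Set.ncard_coe_finset, Nat.card_Icc] at h1
  have h2 := Set.ncard_image_le (f := fun x : Vertex p => (x.2 : ℕ)) (Set.toFinite S)
  omega

/-! ### Counting vertices and classes row by row -/

lemma sum_ncard_fiber {α ι : Type*} [Finite α] [Fintype ι] (f : α → ι) (T : Set α) :
    ∑ i, {x | x ∈ T ∧ f x = i}.ncard = T.ncard := by
  classical
  have := Fintype.ofFinite α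
  rw [Set.ncard_eq_toFinset_card' T,
    Finset.card_eq_sum_card_fiberwise (f := f) (t := Finset.univ) (fun _ _ => Finset.mem_univ _)]
  refine Finset.sum_congr rfl fun i _ => ?_
  rw [Set.ncard_eq_toFinset_card']
  congr 1
  ext x
  simp

/-- The row of a class. -/
def EqClass.row : EqClass p t → Fin k :=
  Quotient.lift Prod.fst (by rintro u v (rfl | ⟨h, -⟩); exacts [rfl, h])

lemma classesInRow_support (W : Set (EqClass p t)) (i : Fin k) :
    classesInRow t (support W) i = {c | c ∈ W ∧ c.row = i} := by
  ext c
  constructor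
  · rintro ⟨v, ⟨hv, hvi⟩, rfl⟩
    exact ⟨hv, hvi⟩
  · induction c using Quotient.inductionOn with
    | h v => rintro ⟨hv, hvi⟩; exact ⟨v, ⟨hv, hvi⟩, rfl⟩

lemma sum_ncard_classesInRow (W : Set (EqClass p t)) :
    ∑ i, (classesInRow t (support W) i).ncard = W.ncard := by
  simp only [classesInRow_support]
  exact sum_ncard_fiber EqClass.row W

lemma IsSemiSeparator.ncard_le {W : Set (EqClass p t)} {S : Set (Vertex p)}
    (h : IsSemiSeparator t (support W) S) : S.ncard ≤ W.ncard := by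
  rw [← sum_ncard_classesInRow W, ← sum_ncard_fiber Prod.fst S]
  exact Finset.sum_le_sum fun i _ => h.2.1 i

lemma IsSemiSeparator.classesInRow_nonempty {W : Set (EqClass p t)} {S : Set (Vertex p)}
    (h : IsSemiSeparator t (support W) S) (hJ : 0 < numCols p) (i : Fin k) :
    (classesInRow t (support W) i).Nonempty := by
  have h1 := (h.1.rowPart_nonempty hJ i).ncard_pos (Set.toFinite _)
  exact Set.nonempty_of_ncard_ne_zero (by have := h.2.1 i; omega)

lemma IsMinimalSemiSeparator.minimal {X S : Set (Vertex p)} (h : IsMinimalSemiSeparator t X S) :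
    Minimal IsVerticalSeparator S := by
  refine ⟨h.1.1, fun A hA hAS => h.2 ⟨hA, fun i => ?_, fun i c hc v hv => ?_⟩ hAS⟩
  · have hsub : rowPart A i ⊆ rowPart S i := fun x hx => ⟨hAS hx.1, hx.2⟩
    exact (Set.ncard_le_ncard hsub (Set.toFinite _)).trans (h.1.2.1 i)
  · exact h.1.2.2 i c hc v ⟨hAS hv.1, hv.2⟩

lemma IsMinimalSemiSeparator.col_le {W : Set (EqClass p t)} {S : Set (Vertex p)}
    (h : IsMinimalSemiSeparator t (support W) S) {u v : Vertex p} (hu : u ∈ S) (hv : v ∈ S) :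
    (v.2 : ℕ) + 1 ≤ u.2 + W.ncard :=
  (col_le_of_minimal h.minimal hu hv).trans (Nat.add_le_add_left h.1.ncard_le _)

lemma exists_isMinimalSemiSeparator {X S : Set (Vertex p)} (h : IsSemiSeparator t X S) :
    ∃ S', IsMinimalSemiSeparator t X S' := by
  obtain ⟨S', -, hS'⟩ := (Set.toFinite {S | IsSemiSeparator t X S}).exists_le_minimal h
  exact ⟨S', hS'⟩

/-- If each of `k` rows has at least one class and there are at most `k + t` classes, then among any
`t + 1` rows one has exactly one class. -/
lemma exists_eq_one_of_sum_le {n : Fin k → ℕ} (hn : ∀ i, 1 ≤ n i) (hsum : ∑ i, n i ≤ k + t)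
    {A : Finset (Fin k)} (hA : t < A.card) : ∃ i ∈ A, n i = 1 := by
  by_contra! hne
  have h1 : ∑ i : Fin k, (1 + if i ∈ A then 1 else 0) ≤ ∑ i, n i := by
    refine Finset.sum_le_sum fun i _ => ?_
    have := hn i
    split_ifs with hi
    · have := hne i hi; omega
    · omega
  rw [Finset.sum_add_distrib] at h1
  simp at h1
  omega

/-! ### Periods -/

lemma colCong_of_toClass_eq {u v : Vertex p} (h : toClass p t u = toClass p t v) :
    (period p t u.1 : ℤ) ∣ ((u.2 : ℕ) : ℤ) - ((v.2 : ℕ) : ℤ) := by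
  rcases Quotient.exact h with rfl | ⟨-, -, -, hd⟩
  · simp
  · exact hd

/-- The factor `p j` occurs in the periods of the `t + 1` rows that precede `j` cyclically. -/
lemma exists_rows_dvd_period (p : Fin k → ℕ) (htk : t + 1 ≤ k) (j : Fin k) :
    ∃ A : Finset (Fin k), A.card = t + 1 ∧ ∀ i ∈ A, endWidth k * p j ∣ period p t i := by
  have hk := j.pos
  refine ⟨(Finset.range (t + 1)).image fun s => ⟨((j : ℕ) + (k - s)) % k, Nat.mod_lt _ hk⟩, ?_, ?_⟩
  · rw [Finset.card_image_of_injOn, Finset.card_range]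
    intro a ha b hb hab
    simp only [Finset.coe_range, Set.mem_Iio] at ha hb
    have h1 : (j : ℕ) + (k - a) ≡ j + (k - b) [MOD k] := Fin.mk.inj hab
    have h2 := Nat.ModEq.add_left_cancel' _ h1
    have h3 : a ≡ b [MOD k] := by
      have h4 : k - a + (a + b) ≡ k - b + (a + b) [MOD k] := h2.add_right _
      have e1 : k - a + (a + b) = k + b := by omega
      have e2 : k - b + (a + b) = k + a := by omega
      rw [e1, e2] at h4
      exact (Nat.ModEq.add_left_cancel' _ h4).symm
    rwa [Nat.ModEq, Nat.mod_eq_of_lt (by omega), Nat.mod_eq_of_lt (by omega)] at h3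
  · intro i hi
    obtain ⟨s, hs, rfl⟩ := Finset.mem_image.1 hi
    rw [Finset.mem_range] at hs
    refine Nat.mul_dvd_mul_left _ ?_
    have hj : j = ⟨(((j : ℕ) + (k - s)) % k + s) % k, Nat.mod_lt _ hk⟩ := by
      apply Fin.ext
      have e : (j : ℕ) + (k - s) + s = j + k := by omega
      simp only [Nat.mod_add_mod, e, Nat.add_mod_right]
      exact (Nat.mod_eq_of_lt j.2).symm
    conv_lhs => rw [hj]
    exact Finset.dvd_prod_of_mem
      (fun s' => p ⟨(((j : ℕ) + (k - s)) % k + s') % k, Nat.mod_lt _ hk⟩) (Finset.mem_range.2 hs)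

lemma numCols_dvd (hcop : ∀ i j : Fin k, i ≠ j → Nat.Coprime (p i) (p j)) (hk : 0 < k) {D : ℤ}
    (hD : ∀ j, ((endWidth k * p j : ℕ) : ℤ) ∣ D) : (numCols p : ℤ) ∣ D := by
  have hk0 : 0 < endWidth k := by unfold endWidth; omega
  have hD' : ∀ j, endWidth k * p j ∣ D.natAbs := fun j => Int.natCast_dvd.1 (hD j)
  obtain ⟨E, hE⟩ : endWidth k ∣ D.natAbs := (Dvd.intro _ rfl).trans (hD' ⟨0, hk⟩)
  rw [Int.natCast_dvd, numCols, hE]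
  refine Nat.mul_dvd_mul_left _ ?_
  refine Finset.prod_dvd_of_isRelPrime (fun i _ j _ hij => Nat.coprime_iff_isRelPrime.1 (hcop i j hij)) ?_
  intro j _
  have := hD' j
  rw [hE] at this
  exact Nat.dvd_of_mul_dvd_mul_left hk0 this

/-! ### Comparing semi-separators -/

/-- Minimal semi-separators for two sets whose union has at most `k + t` classes agree in every row
that contains only one class of the union. -/
lemma rowPart_eq_of_union (hcop : ∀ i j : Fin k, i ≠ j → Nat.Coprime (p i) (p j))
    (hJ : 0 < numCols p) (htk : t + 1 ≤ k) {W W' : Set (EqClass p t)}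
    (hU : (W ∪ W').ncard ≤ k + t) {S S' : Set (Vertex p)}
    (hS : IsMinimalSemiSeparator t (support W) S)
    (hS' : IsMinimalSemiSeparator t (support W') S') {r : Fin k}
    (hr : (classesInRow t (support (W ∪ W')) r).ncard = 1) : rowPart S r = rowPart S' r := by
  have hsubl : ∀ i, classesInRow t (support W) i ⊆ classesInRow t (support (W ∪ W')) i := by
    intro i; simp only [classesInRow_support]; exact fun c hc => ⟨Or.inl hc.1, hc.2⟩
  have hsubr : ∀ i, classesInRow t (support W') i ⊆ classesInRow t (support (W ∪ W')) i := by
    intro i; simp only [classesInRow_support]; exact fun c hc => ⟨Or.inr hc.1, hc.2⟩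
  have hWc : W.ncard ≤ k + t :=
    (Set.ncard_le_ncard Set.subset_union_left (Set.toFinite _)).trans hU
  have hWc' : W'.ncard ≤ k + t :=
    (Set.ncard_le_ncard Set.subset_union_right (Set.toFinite _)).trans hU
  have hpos : ∀ i, 1 ≤ (classesInRow t (support (W ∪ W')) i).ncard := fun i =>
    ((hS.1.classesInRow_nonempty hJ i).mono (hsubl i)).ncard_pos (Set.toFinite _)
  -- in a row with a single class, both separators have exactly one vertex, and these are equivalent
  have hsingle : ∀ i, (classesInRow t (support (W ∪ W')) i).ncard = 1 →
      ∃ v v', rowPart S i = {v} ∧ rowPart S' i = {v'} ∧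
        (period p t i : ℤ) ∣ ((v.2 : ℕ) : ℤ) - ((v'.2 : ℕ) : ℤ) := by
    intro i hi
    obtain ⟨c, hc⟩ := Set.ncard_eq_one.1 hi
    have e : classesInRow t (support W) i = {c} :=
      (hS.1.classesInRow_nonempty hJ i).subset_singleton_iff.1 (hc ▸ hsubl i)
    have e' : classesInRow t (support W') i = {c} :=
      (hS'.1.classesInRow_nonempty hJ i).subset_singleton_iff.1 (hc ▸ hsubr i)
    have n1 := hS.1.2.1 i
    have n1' := hS'.1.2.1 i
    have n2 := (hS.1.1.rowPart_nonempty hJ i).ncard_pos (Set.toFinite _)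
    have n2' := (hS'.1.1.rowPart_nonempty hJ i).ncard_pos (Set.toFinite _)
    rw [e, Set.ncard_singleton] at n1
    rw [e', Set.ncard_singleton] at n1'
    obtain ⟨v, hv⟩ := Set.ncard_eq_one.1 (le_antisymm n1 n2)
    obtain ⟨v', hv'⟩ := Set.ncard_eq_one.1 (le_antisymm n1' n2')
    have mv : v ∈ rowPart S i := hv ▸ rfl
    have mv' : v' ∈ rowPart S' i := hv' ▸ rfl
    refine ⟨v, v', hv, hv', ?_⟩
    have := colCong_of_toClass_eq
      ((hS.1.2.2 i c e v mv).trans (hS'.1.2.2 i c e' v' mv').symm)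
    rwa [mv.2] at this
  obtain ⟨v, v', hv, hv', hd⟩ := hsingle r hr
  have mv : v ∈ rowPart S r := hv ▸ rfl
  have mv' : v' ∈ rowPart S' r := hv' ▸ rfl
  -- the shift in row `r` is divisible by the period of every row with a single class
  have hall : ∀ i, (classesInRow t (support (W ∪ W')) i).ncard = 1 →
      (period p t i : ℤ) ∣ ((v.2 : ℕ) : ℤ) - ((v'.2 : ℕ) : ℤ) := by
    intro i hi
    obtain ⟨u, u', hu, hu', hd'⟩ := hsingle i hi
    have mu : u ∈ rowPart S i := hu ▸ rfl
    have mu' : u' ∈ rowPart S' i := hu' ▸ rfl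
    have hend : ∀ i, (endWidth k : ℤ) ∣ period p t i := fun i =>
      Int.natCast_dvd_natCast.2 (Dvd.intro _ rfl)
    have hdd := dvd_sub ((hend r).trans hd) ((hend i).trans hd')
    have h1 := hS.col_le mv.1 mu.1
    have h2 := hS.col_le mu.1 mv.1
    have h3 := hS'.col_le mv'.1 mu'.1
    have h4 := hS'.col_le mu'.1 mv'.1
    have h0 := Int.eq_zero_of_abs_lt_dvd hdd (by
      rw [abs_lt]; unfold endWidth; push_cast; constructor <;> omega)
    rw [sub_eq_zero.1 h0]
    exact hd'
  have hJd : (numCols p : ℤ) ∣ ((v.2 : ℕ) : ℤ) - ((v'.2 : ℕ) : ℤ) := by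
    refine numCols_dvd hcop r.pos fun j => ?_
    obtain ⟨A, hAc, hA⟩ := exists_rows_dvd_period p htk j
    obtain ⟨i, hiA, hi⟩ := exists_eq_one_of_sum_le hpos
      ((sum_ncard_classesInRow (W ∪ W')).trans_le hU) (A := A) (by omega)
    exact (Int.natCast_dvd_natCast.2 (hA i hiA)).trans (hall i hi)
  have h0 := Int.eq_zero_of_abs_lt_dvd hJd (by
    have := v.2.2; have := v'.2.2; rw [abs_lt]; constructor <;> omega)
  have hvv : v = v' := Prod.ext (mv.2.trans mv'.2.symm) (Fin.ext (by omega))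
  rw [hv, hv', hvv]

end CylGrid

theorem mainTheorem6 (k w : ℕ) (hk : 3 ≤ k) (p : Fin k → ℕ)
    (hcop : ∀ i j : Fin k, i ≠ j → Nat.Coprime (p i) (p j))
    (hlow : ∀ i, (w : ℝ) / 2 ≤ (p i : ℝ)) (hupp : ∀ i, p i ≤ w)
    (t : ℕ) (ht : 1 ≤ t) (htk : t ≤ k - 1)
    (m : ℕ) (W : Fin m → Set (CylGrid.EqClass p t))
    (hcard : ∀ a, (W a).ncard ≤ k + t)
    (hunion : ∀ a b : Fin m, (a : ℕ) + 1 = (b : ℕ) → (W a ∪ W b).ncard ≤ k + t)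
    (I : Set (Fin k))
    (hI : ∀ r ∈ I, ∃ c : CylGrid.EqClass p t,
      ∀ a, CylGrid.classesInRow t (CylGrid.support (W a)) r = {c})
    (hcrit : ∀ a, CylGrid.IsCritical t (CylGrid.support (W a))) :
    (∀ (a b : Fin m) (S S' : Set (CylGrid.Vertex p)),
      CylGrid.IsMinimalSemiSeparator t (CylGrid.support (W a)) S →
      CylGrid.IsMinimalSemiSeparator t (CylGrid.support (W b)) S' →
      ∀ r ∈ I, CylGrid.rowPart S r = CylGrid.rowPart S' r) ∧
    (I.Nonempty → ∃ j : ℕ, ∀ (a : Fin m) (S : Set (CylGrid.Vertex p)),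
      CylGrid.IsMinimalSemiSeparator t (CylGrid.support (W a)) S →
      ∀ v ∈ S, j ≤ (v.2 : ℕ) ∧ (v.2 : ℕ) ≤ j + 2 * (k + t) - 1) := by
  have hp : ∀ i, 0 < p i := by
    -- `p i = 0` forces `w = 0`, and then two zeros would be coprime
    intro i
    by_contra hi
    have hi0 : p i = 0 := by omega
    have hw : w = 0 := by
      have h1 := hlow i
      rw [hi0, Nat.cast_zero] at h1
      have h2 : (w : ℝ) ≤ 0 := by linarith
      exact_mod_cast le_antisymm h2 (Nat.cast_nonneg w)
    have h01 := hcop ⟨0, by omega⟩ ⟨1, by omega⟩ (by simp)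
    have h0 := hupp ⟨0, by omega⟩
    have h1 := hupp ⟨1, by omega⟩
    rw [hw, Nat.le_zero] at h0 h1
    rw [h0, h1] at h01
    simp at h01
  have hJ : 0 < CylGrid.numCols p :=
    Nat.mul_pos (by unfold CylGrid.endWidth; omega) (Finset.prod_pos fun i _ => hp i)
  have hone : ∀ r ∈ I, ∀ a b,
      (CylGrid.classesInRow t (CylGrid.support (W a ∪ W b)) r).ncard = 1 := by
    intro r hr a b
    obtain ⟨c, hc⟩ := hI r hr
    have hsplit : CylGrid.classesInRow t (CylGrid.support (W a ∪ W b)) r =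
        CylGrid.classesInRow t (CylGrid.support (W a)) r ∪
          CylGrid.classesInRow t (CylGrid.support (W b)) r := by
      simp only [CylGrid.classesInRow_support]
      ext x
      simp only [Set.mem_ofPred_eq, Set.mem_union, or_and_right]
    rw [hsplit, hc a, hc b, Set.union_self, Set.ncard_singleton]
  have hstep : ∀ a b : Fin m, (W a ∪ W b).ncard ≤ k + t → ∀ S S' : Set (CylGrid.Vertex p),
      CylGrid.IsMinimalSemiSeparator t (CylGrid.support (W a)) S →
      CylGrid.IsMinimalSemiSeparator t (CylGrid.support (W b)) S' →
      ∀ r ∈ I, CylGrid.rowPart S r = CylGrid.rowPart S' r := fun a b hab S S' hS hS' r hr =>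
    CylGrid.rowPart_eq_of_union hcop hJ (by omega) hab hS hS' (hone r hr a b)
  have hchain : ∀ (n : ℕ) (a b : Fin m), (a : ℕ) + n = b → ∀ S S' : Set (CylGrid.Vertex p),
      CylGrid.IsMinimalSemiSeparator t (CylGrid.support (W a)) S →
      CylGrid.IsMinimalSemiSeparator t (CylGrid.support (W b)) S' →
      ∀ r ∈ I, CylGrid.rowPart S r = CylGrid.rowPart S' r := by
    intro n
    induction n with
    | zero =>
      intro a b hab
      obtain rfl : a = b := Fin.ext hab
      exact hstep a a (by rw [Set.union_self]; exact hcard a)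
    | succ n ih =>
      intro a b hab S S' hS hS' r hr
      have hlt : (a : ℕ) + n < m := by omega
      obtain ⟨S₁, hS₁⟩ := (hcrit ⟨a + n, hlt⟩).1
      obtain ⟨S₂, hS₂⟩ := CylGrid.exists_isMinimalSemiSeparator hS₁
      exact (ih a ⟨a + n, hlt⟩ rfl S S₂ hS hS₂ r hr).trans
        (hstep ⟨a + n, hlt⟩ b (hunion _ b (by simp only; omega)) S₂ S' hS₂ hS' r hr)
  have hmain : ∀ (a b : Fin m) (S S' : Set (CylGrid.Vertex p)),
      CylGrid.IsMinimalSemiSeparator t (CylGrid.support (W a)) S →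
      CylGrid.IsMinimalSemiSeparator t (CylGrid.support (W b)) S' →
      ∀ r ∈ I, CylGrid.rowPart S r = CylGrid.rowPart S' r := by
    intro a b S S' hS hS' r hr
    rcases le_total (a : ℕ) b with h | h
    · exact hchain (b - a) a b (by omega) S S' hS hS' r hr
    · exact (hchain (a - b) b a (by omega) S' S hS' hS r hr).symm
  refine ⟨hmain, ?_⟩
  rintro ⟨r, hr⟩
  rcases Nat.eq_zero_or_pos m with rfl | hm
  · exact ⟨0, fun a => a.elim0⟩
  obtain ⟨S₁, hS₁⟩ := (hcrit ⟨0, hm⟩).1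
  obtain ⟨S₀, hS₀⟩ := CylGrid.exists_isMinimalSemiSeparator hS₁
  obtain ⟨x, hx⟩ := hS₀.1.1.rowPart_nonempty hJ r
  -- all separators contain `x`, and each of them extends at most `k + t - 1` columns to either side
  refine ⟨(x.2 : ℕ) - (k + t - 1), fun a S hS v hv => ?_⟩
  have hxS : x ∈ CylGrid.rowPart S r := hmain ⟨0, hm⟩ a S₀ S hS₀ hS r hr ▸ hx
  have h1 := hS.col_le hxS.1 hv
  have h2 := hS.col_le hv hxS.1
  have h3 := hcard a
  omega
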